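/- Let $I$ and $J$ be arbitrary (possibly uncountable) index sets. For each $i\in I$ let $X_i$ be a non-empty compact convex subset of a Hausdorff locally convex (real topological vector) space $E_i$, and for each $j\in J$ let $Y_j$ be a non-empty compact convex subset of a Hausdorff locally convex space $F_j$. Put $X:=\prod_{i\in I}X_i$, $Y:=\prod_{j\in J}Y_j$ and $Z:=X\times Y$, with the product topologies. For each $i\in I$ let $\Phi_i:Z\to 2^{X_i}$ be a correspondence (with possibly empty values) such that the set $W_i=\{(x,y)\in Z \mid \Phi_i(x,y)\neq\emptyset\}$ is open in $Z$ and $\Phi_i$ has a continuous selection on $W_i$, i.e. there is a continuous map $f_i:W_i\to X_i$ with $f_i(x,y)\in\Phi_i(x,y)$ for all $(x,y)\in W_i$. For each $j\in J$ let $\Psi_j:Z\to 2^{Y_j}$ be a correspondence with non-empty closed convex values that is upper semicontinuous, i.e. for each $z\in Z$ and each open set $V$ in $Y_j$ with $\Psi_j(z)\subset V$ there is an open neighbourhood $U$ of $z$ in $Z$ such that $\Psi_j(z')\subset V$ for every $z'\in U$. Then there exists a point $(x^*,y^*)\in Z$ such that for each $i\in I$ either $\Phi_i(x^*,y^*)=\emptyset$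 or $x_i^*\in\Phi_i(x^*,y^*)$, and for each $j\in J$, $y_j^*\in\Psi_j(x^*,y^*)$. -/

import Mathlib

/-- The domain `{z | Φ z ≠ ∅}` of a correspondence `Φ : A → 2^B`. -/
def correspondenceDomain {A B : Type*} (Φ : A → Set B) : Set A :=
  {z | Φ z ≠ ∅}

/-- The correspondence `Φ : A → 2^B` has a continuous selection on `W ⊆ A`: a continuous map
`f : W → B` (for the subspace topology on `W`) with `f z ∈ Φ z` for all `z ∈ W`. -/
def HasContinuousSelectionOn {A B : Type*} [TopologicalSpace A] [TopologicalSpace B]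
    (Φ : A → Set B) (W : Set A) : Prop :=
  ∃ f : W → B, Continuous f ∧ ∀ z : W, f z ∈ Φ z

/-! The equilibrium is a fixed point of one correspondence on `Z`. Its `i`-th factor is `{f_i(z)}`
where `Φ_i(z)` is non-empty and all of `X_i` elsewhere; its `j`-th factor is `Ψ_j(z)`. Openness of
`W_i` makes the first kind of factor closed-graph, so the product has closed graph and non-empty
convex values whatever the index sets, and Kakutani–Fan–Glicksberg (`exists_mem_of_isClosed_graph`)
applies in the product space.

That theorem is reduced to Brouwer on a simplex (`exists_isFixedPt_stdSimplex`) by Hahn–Banach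
separation and a partition of unity. Brouwer in turn follows from Scarf's lemma
(`exists_dominant_image_eq_univ`): on a fine grid, a dominant set carrying all colours yields an
approximate fixed point. Scarf's lemma is a parity count resting on the pivot step
`Dominant.exists_two_extensions`. -/

/-! ### Dominant sets and the pivot step -/

/-- A finite set `S` of alternatives (`Sum.inl`) and indices (`Sum.inr`) is dominant when no
alternative beats, for every index outside `S`, the worst alternative of `S`. -/
def Dominant {I X α : Type*} [LinearOrder α] (u : I → X → α) (S : Finset (X ⊕ I)) : Prop :=
  ∀ y, ∃ i, Sum.inr i ∉ S ∧ ∀ x, Sum.inl x ∈ S → u i y ≤ u i x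

namespace Dominant

variable {I X α : Type*} [LinearOrder α] {u : I → X → α} {S T : Finset (X ⊕ I)}

theorem mono (hS : Dominant u S) (h : T ⊆ S) : Dominant u T := fun y => by
  obtain ⟨i, hi, hx⟩ := hS y
  exact ⟨i, fun hT => hi (h hT), fun x hxT => hx x (h hxT)⟩

variable [Fintype I] [DecidableEq I] [DecidableEq X]

/-- In a dominant set with one element less than there are indices, exactly two of the indices
outside the set share their worst alternative. -/
theorem exists_shared_minimizer (hT : Dominant u T) (hu : ∀ i, Function.Injective (u i))
    (hcard : T.card + 1 = Fintype.card I) {x₀ : X} (hx₀ : Sum.inl x₀ ∈ T) :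
    ∃ (μ : I → X) (a b : I), a ≠ b ∧ Sum.inr a ∉ T ∧ Sum.inr b ∉ T ∧ μ a = μ b ∧
      (∀ i, Sum.inl (μ i) ∈ T) ∧ (∀ i x, Sum.inl x ∈ T → u i (μ i) ≤ u i x) ∧
      ∀ i k, Sum.inr i ∉ T → Sum.inr k ∉ T → i ≠ k → μ i = μ k →
        (k = a ∨ k = b) ∧ (i = a ∨ i = b) := by
  have hmin : ∀ i, ∃ m, Sum.inl m ∈ T ∧ ∀ x, Sum.inl x ∈ T → u i m ≤ u i x := fun i => by
    obtain ⟨m, hm, h⟩ := Finset.exists_min_image T.toLeft (u i) ⟨x₀, by simpa using hx₀⟩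
    exact ⟨m, by simpa using hm, fun x hx => h x (by simpa using hx)⟩
  choose μ hμ hμle using hmin
  have hD : (T.toRightᶜ).card = T.toLeft.card + 1 := by
    have h1 := Finset.card_toLeft_add_card_toRight (u := T)
    have h2 := Finset.card_compl_add_card T.toRight
    omega
  -- Dominance tested on a member `x` of `T` says that `x` is worst for some outside index. So `μ`
  -- maps the outside indices onto the alternatives of `T`, which are one fewer: exactly one fibre
  -- is a pair.
  have hsurj : ∀ x, Sum.inl x ∈ T → ∃ i, Sum.inr i ∉ T ∧ μ i = x := fun x hx => by
    obtain ⟨i, hi, h⟩ := hT x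
    exact ⟨i, hi, hu i (le_antisymm (hμle i x hx) (h _ (hμ i)))⟩
  obtain ⟨a, ha, b, hb, hab, hμab⟩ :=
    Finset.exists_ne_map_eq_of_card_lt_of_maps_to (s := T.toRightᶜ) (t := T.toLeft) (f := μ)
      (by omega) (fun i _ => by simpa using hμ i)
  have ha' : Sum.inr a ∉ T := by simpa using ha
  have hb' : Sum.inr b ∉ T := by simpa using hb
  have hinj : ∀ p q, Sum.inr p ∉ T → Sum.inr q ∉ T → p ≠ q → μ p = μ q →
      Set.InjOn μ (T.toRightᶜ.erase p : Finset I) := by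
    intro p q hp hq hpq hμpq
    rw [← Finset.card_image_iff]
    have : (T.toRightᶜ.erase p).image μ = T.toLeft := by
      ext x
      simp only [Finset.mem_image, Finset.mem_erase, Finset.mem_compl, Finset.mem_toRight,
        Finset.mem_toLeft]
      constructor
      · rintro ⟨i, -, rfl⟩
        exact hμ i
      · intro hx
        obtain ⟨i, hi, rfl⟩ := hsurj x hx
        by_cases hip : i = p
        · exact ⟨q, ⟨hpq.symm, hq⟩, by rw [hip, hμpq]⟩
        · exact ⟨i, ⟨hip, hi⟩, rfl⟩
    rw [this, Finset.card_erase_of_mem (by simpa using hp)]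
    omega
  have hia := hinj a b ha' hb' hab hμab
  have hib := hinj b a hb' ha' hab.symm hμab.symm
  refine ⟨μ, a, b, hab, ha', hb', hμab, hμ, hμle, fun i k hi hk hik h => ?_⟩
  have h1 : i = a ∨ k = a := by
    by_contra! hne
    exact hik (hia (by simp [hne.1, hi]) (by simp [hne.2, hk]) h)
  have h2 : i = b ∨ k = b := by
    by_contra! hne
    exact hik (hib (by simp [hne.1, hi]) (by simp [hne.2, hk]) h)
  grind

/-- A dominant set with one element less than there are indices, and which contains an alternative,
has exactly two dominant one-element extensions. -/
theorem exists_two_extensions [Finite X] (hT : Dominant u T) (hu : ∀ i, Function.Injective (u i))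
    (hcard : T.card + 1 = Fintype.card I) {x₀ : X} (hx₀ : Sum.inl x₀ ∈ T) :
    ∃ e₁ e₂, e₁ ≠ e₂ ∧ ∀ e, (e ∉ T ∧ Dominant u (insert e T)) ↔ e = e₁ ∨ e = e₂ := by
  obtain ⟨μ, a, b, hab, ha, hb, hμab, hμ, hμle, hpair⟩ :=
    hT.exists_shared_minimizer hu hcard hx₀
  -- Only `p` can prevent an element of `M p` from beating `T`. The pivot at `p` adds the `p`-best
  -- element of `M p`, or the index `p` itself if `M p` is empty.
  let M : I → Set X := fun p => {y | ∀ k, Sum.inr k ∉ T → k ≠ p → u k (μ k) < u k y}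
  let P : I → X ⊕ I → Prop := fun p e =>
    e ∉ T ∧ Dominant u (insert e T) ∧ (e = Sum.inr p ∨ ∃ y ∈ M p, e = Sum.inl y)
  have hexists : ∀ p q, Sum.inr p ∉ T → Sum.inr q ∉ T → p ≠ q → μ p = μ q → ∃ e, P p e := by
    intro p q hp hq hpq hμpq
    by_cases hM : (M p).Nonempty
    · obtain ⟨y, hy, hmax⟩ := Set.exists_max_image (M p) (u p) (Set.toFinite _) hM
      refine ⟨Sum.inl y, fun hyT => ?_, fun z => ?_, Or.inr ⟨y, hy, rfl⟩⟩
      · obtain ⟨i, hi, h⟩ := hT y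
        have hip : i = p := by
          by_contra hip
          exact absurd (hy i hi hip) (not_lt.2 (h _ (hμ i)))
        subst hip
        have h1 : y = μ i := hu i (le_antisymm (h _ (hμ i)) (hμle i y hyT))
        have h2 := hy q hq hpq.symm
        rw [h1, hμpq] at h2
        exact lt_irrefl _ h2
      · by_cases hz : z ∈ M p
        · obtain ⟨i, hi, h⟩ := hT z
          have hip : i = p := by
            by_contra hip
            exact absurd (hz i hi hip) (not_lt.2 (h _ (hμ i)))
          subst hip
          refine ⟨i, by simpa using hi, fun x hx => ?_⟩
          rcases Finset.mem_insert.1 hx with hx | hx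
          · rw [Sum.inl.inj hx]
            exact hmax z hz
          · exact h x hx
        · simp only [M, Set.mem_ofPred_eq, not_forall, not_lt] at hz
          obtain ⟨k, hk, hkp, hle⟩ := hz
          refine ⟨k, by simpa using hk, fun x hx => ?_⟩
          rcases Finset.mem_insert.1 hx with hx | hx
          · rw [Sum.inl.inj hx]
            exact hle.trans (hy k hk hkp).le
          · exact hle.trans (hμle k x hx)
    · refine ⟨Sum.inr p, hp, fun z => ?_, Or.inl rfl⟩
      have hz : z ∉ M p := fun hz => hM ⟨z, hz⟩
      simp only [M, Set.mem_ofPred_eq, not_forall, not_lt] at hz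
      obtain ⟨k, hk, hkp, hle⟩ := hz
      refine ⟨k, by simp [hk, hkp], fun x hx => hle.trans (hμle k x (by simpa using hx))⟩
  have hforced : ∀ p e z, z ∈ M p → Dominant u (insert e T) →
      Sum.inr p ∉ insert e T ∧ ∀ x, Sum.inl x ∈ insert e T → u p z ≤ u p x := by
    intro p e z hz he
    obtain ⟨i, hi, h⟩ := he z
    have hip : i = p := by
      by_contra hip
      exact absurd (hz i (fun h' => hi (Finset.mem_insert_of_mem h')) hip)
        (not_lt.2 (h _ (Finset.mem_insert_of_mem (hμ i))))
    subst hip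
    exact ⟨hi, h⟩
  have hunique : ∀ p e e', P p e → P p e' → e = e' := by
    rintro p e e' ⟨-, hd, h⟩ ⟨-, hd', h'⟩
    rcases h with rfl | ⟨y, hy, rfl⟩ <;> rcases h' with rfl | ⟨y', hy', rfl⟩
    · rfl
    · exact absurd (Finset.mem_insert_self _ _) (hforced p _ y' hy' hd).1
    · exact absurd (Finset.mem_insert_self _ _) (hforced p _ y hy hd').1
    · have h1 := (hforced p _ y' hy' hd).2 y (Finset.mem_insert_self _ _)
      have h2 := (hforced p _ y hy hd').2 y' (Finset.mem_insert_self _ _)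
      rw [hu p (le_antisymm h2 h1)]
  have hcover : ∀ e, e ∉ T → Dominant u (insert e T) → P a e ∨ P b e := by
    rintro (y | k) he hd
    · obtain ⟨k, hk, h⟩ := hd y
      have hk' : Sum.inr k ∉ T := fun h' => hk (Finset.mem_insert_of_mem h')
      -- The new `y` is worst for `k`, so each old alternative must be worst for an index other than
      -- `k`. Hence `k` belongs to the shared pair.
      have key : ∀ j, ∃ i, Sum.inr i ∉ T ∧ i ≠ k ∧ μ i = μ j ∧ u i (μ i) < u i y := by
        intro j
        obtain ⟨i, hi, h'⟩ := hd (μ j)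
        have hi' : Sum.inr i ∉ T := fun h' => hi (Finset.mem_insert_of_mem h')
        have hne : μ j ≠ y := fun hy => he (hy ▸ hμ j)
        have hji : μ i = μ j := hu i (le_antisymm (hμle i _ (hμ j))
          (h' _ (Finset.mem_insert_of_mem (hμ i))))
        have hle := h' y (Finset.mem_insert_self _ _)
        refine ⟨i, hi', ?_, hji, ?_⟩
        · rintro rfl
          exact hne (hu i (le_antisymm hle (h _ (Finset.mem_insert_of_mem (hμ j)))))
        · rw [hji]
          exact lt_of_le_of_ne hle fun h'' => hne (hu i h'')
      have hyM : y ∈ M k := by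
        intro j hj hjk
        obtain ⟨i, hi, hik, hij, hlt⟩ := key j
        by_cases hij' : i = j
        · exact hij' ▸ hlt
        · obtain ⟨i', hi', hik', hij'', -⟩ := key k
          have h1 := hpair i j hi hj hij' hij
          have h2 := hpair i' k hi' hk' hik' hij''
          grind
      have hkab : k = a ∨ k = b := by
        obtain ⟨i, hi, hik, hij, -⟩ := key k
        exact (hpair i k hi hk' hik hij).1
      rcases hkab with rfl | rfl
      · exact Or.inl ⟨he, hd, Or.inr ⟨y, hyM, rfl⟩⟩
      · exact Or.inr ⟨he, hd, Or.inr ⟨y, hyM, rfl⟩⟩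
    · obtain ⟨i, hi, h⟩ := hd (μ k)
      have hi' : Sum.inr i ∉ T := fun h' => hi (Finset.mem_insert_of_mem h')
      have hik : i ≠ k := by
        rintro rfl
        exact hi (Finset.mem_insert_self _ _)
      have hik' : μ i = μ k := hu i (le_antisymm (hμle i _ (hμ k))
        (h _ (Finset.mem_insert_of_mem (hμ i))))
      rcases (hpair i k hi' he hik hik').1 with rfl | rfl
      · exact Or.inl ⟨he, hd, Or.inl rfl⟩
      · exact Or.inr ⟨he, hd, Or.inl rfl⟩
  obtain ⟨e₁, h₁⟩ := hexists a b ha hb hab hμab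
  obtain ⟨e₂, h₂⟩ := hexists b a hb ha hab.symm hμab.symm
  refine ⟨e₁, e₂, ?_, fun e => ⟨fun h => ?_, ?_⟩⟩
  -- A common extension could only be an alternative in `M a ∩ M b`, which would beat `T` at every
  -- outside index.
  · rintro rfl
    rcases h₁.2.2 with h | ⟨y, hy, h⟩ <;> rcases h₂.2.2 with h' | ⟨y', hy', h'⟩
    · exact hab (Sum.inr.inj (h.symm.trans h'))
    · cases h.symm.trans h'
    · cases h.symm.trans h'
    · obtain rfl := Sum.inl.inj (h.symm.trans h')
      obtain ⟨i, hi, hle⟩ := hT y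
      by_cases hia : i = a
      · exact absurd (hy' i hi (hia ▸ hab)) (not_lt.2 (hle _ (hμ i)))
      · exact absurd (hy i hi hia) (not_lt.2 (hle _ (hμ i)))
  · exact (hcover e h.1 h.2).imp (fun h' => hunique a _ _ h' h₁) fun h' => hunique b _ _ h' h₂
  · rintro (rfl | rfl)
    · exact ⟨h₁.1, h₁.2.1⟩
    · exact ⟨h₂.1, h₂.2.1⟩

end Dominant

/-! ### Parity counting and Scarf's lemma -/

/-- If `S` has as many elements as there are colours but misses a colour, then evenly many of its
elements leave, when removed, exactly the colours other than `i₀`. -/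
theorem even_card_filter_image_erase {I B : Type*} [Fintype I] [DecidableEq I] [DecidableEq B]
    (col : B → I) (i₀ : I) (S : Finset B) (hS : S.card = Fintype.card I)
    (hcol : S.image col ≠ Finset.univ) :
    Even (S.filter fun e => (S.erase e).image col = Finset.univ.erase i₀).card := by
  rcases Finset.eq_empty_or_nonempty
    (S.filter fun e => (S.erase e).image col = Finset.univ.erase i₀) with h | ⟨e, he⟩
  · simp [h]
  obtain ⟨heS, he⟩ := Finset.mem_filter.1 he
  have hne : col e ≠ i₀ := by
    intro hc
    apply hcol
    rw [← Finset.insert_erase heS, Finset.image_insert, he, hc,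
      Finset.insert_erase (Finset.mem_univ _)]
  have hinj : Set.InjOn col (S.erase e : Finset B) := by
    rw [← Finset.card_image_iff, he, Finset.card_erase_of_mem heS,
      Finset.card_erase_of_mem (Finset.mem_univ _), hS, Finset.card_univ]
  obtain ⟨e', he', hee'⟩ := Finset.mem_image.1
    (show col e ∈ (S.erase e).image col by rw [he]; simp [hne])
  have hne' := (Finset.mem_erase.1 he').1
  have he'S := (Finset.mem_erase.1 he').2
  -- `e` and `e'` are the only two elements of `S` with equal colours, so removing either, and
  -- nothing else, keeps every colour but `i₀`.
  have : (S.filter fun d => (S.erase d).image col = Finset.univ.erase i₀) = {e, e'} := by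
    ext d
    simp only [Finset.mem_filter, Finset.mem_insert, Finset.mem_singleton]
    constructor
    · rintro ⟨hd, hdc⟩
      by_contra! hde
      have hmem : col d ∈ (S.erase d).image col := by
        rw [hdc, ← he]
        exact Finset.mem_image_of_mem _ (Finset.mem_erase.2 ⟨hde.1, hd⟩)
      obtain ⟨g, hg, hgd⟩ := Finset.mem_image.1 hmem
      obtain ⟨hgd', hgS⟩ := Finset.mem_erase.1 hg
      by_cases hge : g = e
      · subst hge
        exact hde.2 (hinj (by simp [hde.1, hd]) (by simpa using ⟨he'S, hne'⟩)
          (hgd.symm.trans hee'.symm))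
      · exact hgd' (hinj (by simp [hge, hgS]) (by simp [hde.1, hd]) hgd)
    · rintro (rfl | rfl)
      · exact ⟨heS, he⟩
      · refine ⟨he'S, ?_⟩
        rw [← he]
        ext c
        simp only [Finset.mem_image, Finset.mem_erase]
        constructor
        · rintro ⟨g, ⟨hg, hgS⟩, rfl⟩
          by_cases hge : g = e
          · exact ⟨d, ⟨hne', he'S⟩, by rw [hge, hee']⟩
          · exact ⟨g, ⟨hge, hgS⟩, rfl⟩
        · rintro ⟨g, ⟨hg, hgS⟩, rfl⟩
          by_cases hge : g = d
          · exact ⟨e, ⟨hne'.symm, heS⟩, by rw [hge, hee']⟩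
          · exact ⟨g, ⟨hge, hgS⟩, rfl⟩
  rw [this, Finset.card_pair hne'.symm]
  exact even_two

/-- **Scarf's lemma** for dominant sets: every colouring of the alternatives by the indices admits
a dominant set all of whose colours are distinct and which exhausts the colours. -/
theorem exists_dominant_image_eq_univ {I X α : Type*} [LinearOrder α] [Fintype I] [DecidableEq I]
    [Fintype X] [DecidableEq X] [Nonempty X] [Nonempty I] (u : I → X → α)
    (hu : ∀ i, Function.Injective (u i)) (c : X → I) :
    ∃ S : Finset (X ⊕ I), Dominant u S ∧ S.image (Sum.elim c id) = Finset.univ := by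
  classical
  by_contra! hno
  obtain ⟨i₀⟩ := ‹Nonempty I›
  set col : X ⊕ I → I := Sum.elim c id with hcoldef
  -- Incidences between doors `T`, coloured by all but `i₀`, and rooms `insert e T`. Counted by
  -- rooms they are even if no room has all colours; counted by doors they are odd.
  let P : Finset (Finset (X ⊕ I) × (X ⊕ I)) := Finset.univ.filter fun p =>
    p.1.card + 1 = Fintype.card I ∧ p.1.image col = Finset.univ.erase i₀ ∧
      p.2 ∉ p.1 ∧ Dominant u (insert p.2 p.1)
  have hpos : 0 < Fintype.card I := Fintype.card_pos_iff.2 ⟨i₀⟩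
  have hrooms : Even P.card := by
    rw [Finset.card_eq_sum_card_fiberwise (f := fun p => insert p.2 p.1) (t := Finset.univ)
      (fun _ _ => by simp)]
    refine Finset.even_sum _ fun S _ => ?_
    by_cases hS : Dominant u S ∧ S.card = Fintype.card I
    · have := even_card_filter_image_erase col i₀ S hS.2 (hno S hS.1)
      refine (congrArg Even (Finset.card_bij (fun e _ => (S.erase e, e)) ?_ ?_ ?_)).mp this
      · intro e he
        obtain ⟨heS, he⟩ := Finset.mem_filter.1 he
        refine Finset.mem_filter.2 ⟨Finset.mem_filter.2 ⟨Finset.mem_univ _, ?_, he,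
          Finset.notMem_erase e S, ?_⟩, Finset.insert_erase heS⟩
        · rw [Finset.card_erase_of_mem heS, hS.2]
          omega
        · rw [Finset.insert_erase heS]
          exact hS.1
      · intro e _ e' _ h
        exact (Prod.mk.inj h).2
      · rintro ⟨T, e⟩ h
        simp only [P, Finset.mem_filter, Finset.mem_univ, true_and] at h
        obtain ⟨⟨-, hc, he, -⟩, rfl⟩ := h
        exact ⟨e, by simp [Finset.erase_insert he, hc], by simp [Finset.erase_insert he]⟩
    · convert Even.zero
      rw [Finset.card_eq_zero, Finset.filter_eq_empty_iff]
      rintro ⟨T, e⟩ h rfl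
      simp only [P, Finset.mem_filter, Finset.mem_univ, true_and] at h
      exact hS ⟨h.2.2.2, by rw [Finset.card_insert_of_notMem h.2.2.1, h.1]⟩
  have hfiber : ∀ T : Finset (X ⊕ I), T.card + 1 = Fintype.card I →
      T.image col = Finset.univ.erase i₀ →
      (P.filter fun p => p.1 = T).card =
        (Finset.univ.filter fun e => e ∉ T ∧ Dominant u (insert e T)).card := by
    intro T h1 h2
    symm
    refine Finset.card_bij (fun e _ => (T, e)) ?_ ?_ ?_
    · intro e he
      simpa [P, h1, h2] using he
    · intro e _ e' _ h
      exact (Prod.mk.inj h).2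
    · rintro ⟨T', e⟩ h
      simp only [P, Finset.mem_filter, Finset.mem_univ, true_and] at h
      obtain ⟨⟨-, -, h⟩, rfl⟩ := h
      exact ⟨e, by simpa using h, rfl⟩
  -- The boundary door: the only one without alternatives. Its sole extension adds the best
  -- alternative for `i₀`.
  let T₀ : Finset (X ⊕ I) := (Finset.univ.erase i₀).map Function.Embedding.inr
  have hT₀l : ∀ x, Sum.inl x ∉ T₀ := by simp [T₀]
  have hT₀r : ∀ i, Sum.inr i ∈ T₀ ↔ i ≠ i₀ := by simp [T₀]
  have hT₀ : (P.filter fun p => p.1 = T₀).card = 1 := by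
    rw [hfiber T₀]
    · obtain ⟨m, hm⟩ := Finite.exists_max (u i₀)
      rw [Finset.card_eq_one]
      refine ⟨Sum.inl m, ?_⟩
      ext e
      simp only [Finset.mem_filter, Finset.mem_univ, true_and, Finset.mem_singleton]
      constructor
      · rintro ⟨he, hd⟩
        obtain ⟨i, hi, h⟩ := hd m
        have hi' : i = i₀ := by
          by_contra hne
          exact hi (Finset.mem_insert_of_mem ((hT₀r i).2 hne))
        subst hi'
        rcases e with x | k
        · exact congrArg _ (hu i (le_antisymm (hm x) (h x (Finset.mem_insert_self _ _))))
        · have : k = i := by simpa [hT₀r] using he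
          exact absurd (this ▸ Finset.mem_insert_self _ _) hi
      · rintro rfl
        refine ⟨hT₀l m, fun y => ⟨i₀, by simp [hT₀r], fun x hx => ?_⟩⟩
        rcases Finset.mem_insert.1 hx with hx | hx
        · rw [Sum.inl.inj hx]
          exact hm y
        · exact absurd hx (hT₀l x)
    · simp only [T₀, Finset.card_map, Finset.card_erase_of_mem (Finset.mem_univ _),
        Finset.card_univ]
      omega
    · ext i
      simp [T₀, col]
  have hdoors : ∀ T, T ≠ T₀ → Even (P.filter fun p => p.1 = T).card := by
    intro T hTT₀
    by_cases hne : (P.filter fun p => p.1 = T) = ∅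
    · simp [hne]
    obtain ⟨⟨T', e⟩, he⟩ := Finset.nonempty_iff_ne_empty.2 hne
    simp only [P, Finset.mem_filter, Finset.mem_univ, true_and] at he
    obtain ⟨⟨h1, h2, he, hd⟩, rfl⟩ := he
    have hx : ∃ x, Sum.inl x ∈ T' := by
      by_contra! hx
      apply hTT₀
      ext (x | i)
      · simp [hx, hT₀l]
      · rw [hT₀r]
        constructor
        · rintro hi rfl
          have : i ∈ T'.image col := Finset.mem_image.2 ⟨_, hi, rfl⟩
          simp [h2] at this
        · intro hi
          obtain ⟨g, hg, hgi⟩ := Finset.mem_image.1 (show i ∈ T'.image col by simp [h2, hi])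
          rcases g with x | k
          · exact absurd hg (hx x)
          · rwa [← show k = i from hgi]
    obtain ⟨x₀, hx₀⟩ := hx
    obtain ⟨e₁, e₂, h12, h⟩ := (hd.mono (Finset.subset_insert _ _)).exists_two_extensions hu h1 hx₀
    rw [hfiber T' h1 h2]
    have : (Finset.univ.filter fun e => e ∉ T' ∧ Dominant u (insert e T')) = {e₁, e₂} := by
      ext e
      simp [h]
    rw [this, Finset.card_pair h12]
    exact even_two
  have : P.card = 1 + ∑ T ∈ Finset.univ.erase T₀, (P.filter fun p => p.1 = T).card := by
    rw [Finset.card_eq_sum_card_fiberwise (f := Prod.fst) (t := Finset.univ) (fun _ _ => by simp),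
      ← Finset.add_sum_erase _ _ (Finset.mem_univ T₀), hT₀]
  rw [this] at hrooms
  have : Even (∑ T ∈ Finset.univ.erase T₀, (P.filter fun p => p.1 = T).card) :=
    Finset.even_sum _ fun T hT => hdoors T (Finset.ne_of_mem_erase hT)
  rw [Nat.even_add] at hrooms
  simp [this] at hrooms

/-! ### Brouwer's theorem from Scarf's lemma on a grid -/

/-- The points of the standard simplex whose coordinates are multiples of `1 / N`, scaled by `N`. -/
abbrev SimplexGrid (ι : Type*) [Fintype ι] (N : ℕ) : Type _ :=
  {v : ι → Fin (N + 1) // ∑ i, (v i : ℕ) = N}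

namespace SimplexGrid

variable {ι : Type*} [Fintype ι] {N : ℕ}

/-- The surplus `N - ∑ m` is put on a single coordinate. The case `C = ∅` also shows that the grid
is non-empty. -/
theorem exists_le [Nonempty ι] (C : Finset ι) (m : ι → ℕ) (h : ∑ i ∈ C, m i ≤ N) :
    ∃ v : SimplexGrid ι N, ∀ i ∈ C, C.Nonempty → m i ≤ v.1 i := by
  classical
  obtain ⟨i₀, hi₀⟩ : ∃ i₀, C.Nonempty → i₀ ∈ C := by
    by_cases hC : C.Nonempty
    · exact ⟨hC.choose, fun _ => hC.choose_spec⟩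
    · exact ⟨Classical.arbitrary ι, fun h => absurd h hC⟩
  let w : ι → ℕ := fun i => (if i ∈ C then m i else 0) +
    if i = i₀ then N - ∑ i ∈ C, m i else 0
  have hw : ∑ i, w i = N := by
    simp only [w, Finset.sum_add_distrib, Finset.sum_ite_mem, Finset.univ_inter,
      Finset.sum_ite_eq', Finset.mem_univ, if_true]
    omega
  have hwN : ∀ i, w i < N + 1 := fun i =>
    Nat.lt_succ_of_le (hw ▸ Finset.single_le_sum (fun _ _ => Nat.zero_le _) (Finset.mem_univ i))
  refine ⟨⟨fun i => ⟨w i, hwN i⟩, hw⟩, fun i hi _ => ?_⟩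
  simp [w, hi]

/-- The point of the standard simplex which a grid point represents. -/
noncomputable def toSimplex (hN : 0 < N) (v : SimplexGrid ι N) : stdSimplex ℝ ι :=
  ⟨fun i => (v.1 i : ℕ) / (N : ℝ), fun i => by positivity, by
    rw [← Finset.sum_div, ← Nat.cast_sum, v.2, div_self (by positivity)]⟩

end SimplexGrid

/-- For a self-map `f` of the standard simplex, there is a grid point each of whose coordinates is
either small or not decreased by `f` at some nearby grid point. -/
theorem exists_simplexGrid_le {ι : Type*} [Fintype ι] [Nonempty ι]
    (f : stdSimplex ℝ ι → stdSimplex ℝ ι) {N : ℕ} (hN : 0 < N) :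
    ∃ v : SimplexGrid ι N, ∀ i, (v.1 i : ℕ) ≤ Fintype.card ι ∨
      ∃ w : SimplexGrid ι N, (∀ k, (v.1 k : ℕ) ≤ w.1 k + Fintype.card ι ∧
        (w.1 k : ℕ) ≤ v.1 k + Fintype.card ι) ∧
        (w.toSimplex hN).1 i ≤ (f (w.toSimplex hN)).1 i := by
  classical
  have hne : Nonempty (SimplexGrid ι N) :=
    ⟨(SimplexGrid.exists_le ∅ (fun _ => 0) (by simp)).choose⟩
  have hup : ∀ x : stdSimplex ℝ ι, ∃ i, x.1 i ≤ (f x).1 i := by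
    intro x
    by_contra! h
    have := Finset.sum_lt_sum_of_nonempty Finset.univ_nonempty (fun i _ => h i)
    rw [x.2.2, (f x).2.2] at this
    exact lt_irrefl _ this
  choose c hc using fun v : SimplexGrid ι N => hup (v.toSimplex hN)
  let e := Fintype.equivFin (SimplexGrid ι N)
  obtain ⟨S, hS, hcol⟩ := exists_dominant_image_eq_univ
    -- The enumeration `e` breaks ties between equal `i`-th coordinates, making each ranking
    -- injective.
    (fun (i : ι) (v : SimplexGrid ι N) => toLex ((v.1 i : ℕ), e v))
    (fun i v w h => e.injective (Prod.mk.inj (toLex.injective h)).2) c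
  have hle : ∀ i (v w : SimplexGrid ι N), toLex ((v.1 i : ℕ), e v) ≤ toLex ((w.1 i : ℕ), e w) →
      (v.1 i : ℕ) ≤ w.1 i := by
    intro i v w h
    rcases (Prod.Lex.toLex_le_toLex).1 h with h | h
    · exact h.le
    · exact h.1.le
  have hcover : ∀ i, Sum.inr i ∉ S → ∃ v, Sum.inl v ∈ S ∧ c v = i := by
    intro i hi
    obtain ⟨g, hg, hgi⟩ := Finset.mem_image.1 (show i ∈ S.image (Sum.elim c id) by simp [hcol])
    rcases g with v | k
    · exact ⟨v, hg, hgi⟩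
    · exact absurd (show k = i from hgi) (fun h => hi (h ▸ hg))
  let C : Finset ι := Finset.univ.filter fun i => Sum.inr i ∉ S
  have hC : ∀ i, i ∈ C ↔ Sum.inr i ∉ S := by simp [C]
  obtain ⟨i₀, hi₀, -⟩ := hS hne.some
  obtain ⟨v, hv, -⟩ := hcover i₀ hi₀
  have hmin : ∀ i, ∃ m, Sum.inl m ∈ S ∧ ∀ w, Sum.inl w ∈ S → (m.1 i : ℕ) ≤ w.1 i := fun i => by
    obtain ⟨m, hm, h⟩ := Finset.exists_min_image S.toLeft (fun w => (w.1 i : ℕ))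
      ⟨v, by simpa using hv⟩
    exact ⟨m, by simpa using hm, fun w hw => h w (by simpa using hw)⟩
  choose m hm hmle using hmin
  -- Otherwise some grid point would exceed all the minima over `S` strictly on `C`, against
  -- dominance. The minima thus sum to more than `N - card ι`, which bounds the spread of `S` in
  -- every coordinate.
  have hsum : N < ∑ i ∈ C, (((m i).1 i : ℕ) + 1) := by
    by_contra! h
    obtain ⟨y, hy⟩ := SimplexGrid.exists_le C _ h
    obtain ⟨i, hi, h⟩ := hS y
    have h1 := hle _ _ _ (h _ (hm i))
    have h2 := hy i ((hC i).2 hi) ⟨i, (hC i).2 hi⟩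
    omega
  have hsum' : N < ∑ i ∈ C, ((m i).1 i : ℕ) + Fintype.card ι := by
    rw [Finset.sum_add_distrib, Finset.sum_const, smul_eq_mul, mul_one] at hsum
    exact hsum.trans_le (Nat.add_le_add_left (Finset.card_le_univ C) _)
  have hin : ∀ w, Sum.inl w ∈ S → ∀ i ∈ C, (w.1 i : ℕ) ≤ (m i).1 i + Fintype.card ι := by
    intro w hw i hi
    have h1 := Finset.add_sum_erase C (fun i => ((m i).1 i : ℕ)) hi
    have h2 := Finset.add_sum_erase C (fun i => (w.1 i : ℕ)) hi
    have h3 : ∑ i ∈ C, (w.1 i : ℕ) ≤ N :=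
      (Finset.sum_le_univ_sum_of_nonneg fun _ => Nat.zero_le _).trans_eq w.2
    have h4 : ∑ k ∈ C.erase i, ((m k).1 k : ℕ) ≤ ∑ k ∈ C.erase i, (w.1 k : ℕ) :=
      Finset.sum_le_sum fun k _ => hmle k w hw
    omega
  have hout : ∀ w, Sum.inl w ∈ S → ∀ i, i ∉ C → (w.1 i : ℕ) ≤ Fintype.card ι := by
    intro w hw i hi
    have h1 : ∑ k ∈ insert i C, (w.1 k : ℕ) ≤ N :=
      (Finset.sum_le_univ_sum_of_nonneg fun _ => Nat.zero_le _).trans_eq w.2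
    rw [Finset.sum_insert hi] at h1
    have h4 : ∑ k ∈ C, ((m k).1 k : ℕ) ≤ ∑ k ∈ C, (w.1 k : ℕ) :=
      Finset.sum_le_sum fun k _ => hmle k w hw
    omega
  refine ⟨v, fun i => ?_⟩
  by_cases hi : i ∈ C
  · obtain ⟨w, hw, rfl⟩ := hcover i ((hC i).1 hi)
    refine Or.inr ⟨w, fun k => ?_, hc w⟩
    by_cases hk : k ∈ C
    · have h1 := hin v hv k hk
      have h2 := hin w hw k hk
      have h3 := hmle k v hv
      have h4 := hmle k w hw
      omega
    · have h1 := hout v hv k hk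
      have h2 := hout w hw k hk
      omega
  · exact Or.inl (hout v hv i hi)

/-- **Brouwer's fixed point theorem** for the standard simplex. -/
theorem exists_isFixedPt_stdSimplex {ι : Type*} [Fintype ι] [Nonempty ι]
    (f : stdSimplex ℝ ι → stdSimplex ℝ ι) (hf : Continuous f) : ∃ x, f x = x := by
  classical
  have hcomp : CompactSpace (stdSimplex ℝ ι) :=
    isCompact_iff_compactSpace.1 (isCompact_stdSimplex ℝ ι)
  have happrox : ∀ ε > 0, ∃ x : stdSimplex ℝ ι, ∀ i, x.1 i ≤ (f x).1 i + ε := by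
    intro ε hε
    obtain ⟨δ, hδ, hfδ⟩ := Metric.uniformContinuous_iff.1
      (CompactSpace.uniformContinuous_of_continuous hf) (ε / 2) (half_pos hε)
    obtain ⟨N, hN⟩ := exists_nat_gt ((Fintype.card ι : ℝ) / min δ (ε / 2))
    have hpos : 0 < min δ (ε / 2) := lt_min hδ (half_pos hε)
    have hN0 : (0 : ℝ) < N := lt_of_le_of_lt (by positivity) hN
    have hNn : 0 < N := by exact_mod_cast hN0
    have hsmall : (Fintype.card ι : ℝ) / N < min δ (ε / 2) := by
      rw [div_lt_iff₀ hpos] at hN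
      rw [div_lt_iff₀ hN0]
      linarith
    obtain ⟨v, hv⟩ := exists_simplexGrid_le f hNn
    refine ⟨v.toSimplex hNn, fun i => ?_⟩
    rcases hv i with h | ⟨w, hw, hwi⟩
    · have h1 : (v.toSimplex hNn).1 i ≤ (Fintype.card ι : ℝ) / N := by
        change ((v.1 i : ℕ) : ℝ) / N ≤ _
        gcongr
      have h2 := (f (v.toSimplex hNn)).2.1 i
      have h3 := min_le_right δ (ε / 2)
      linarith
    · have hclose : ∀ k, |(w.toSimplex hNn).1 k - (v.toSimplex hNn).1 k| ≤
          (Fintype.card ι : ℝ) / N := by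
        intro k
        change |((w.1 k : ℕ) : ℝ) / N - ((v.1 k : ℕ) : ℝ) / N| ≤ _
        rw [← sub_div, abs_div, abs_of_pos hN0]
        gcongr
        have h1 : ((v.1 k : ℕ) : ℝ) ≤ (w.1 k : ℕ) + (Fintype.card ι : ℕ) := by
          exact_mod_cast (hw k).1
        have h2 : ((w.1 k : ℕ) : ℝ) ≤ (v.1 k : ℕ) + (Fintype.card ι : ℕ) := by
          exact_mod_cast (hw k).2
        exact abs_le.2 ⟨by linarith, by linarith⟩
      have hdist : dist (w.toSimplex hNn) (v.toSimplex hNn) < δ := by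
        refine lt_of_le_of_lt ?_ (hsmall.trans_le (min_le_left _ _))
        exact (dist_pi_le_iff (by positivity)).2 fun k => by
          rw [Real.dist_eq]
          exact hclose k
      have h1 : |(f (w.toSimplex hNn)).1 i - (f (v.toSimplex hNn)).1 i| < ε / 2 := by
        rw [← Real.dist_eq]
        exact lt_of_le_of_lt (dist_le_pi_dist (f (w.toSimplex hNn)).1 (f (v.toSimplex hNn)).1 i)
          (hfδ hdist)
      have h2 := hsmall.trans_le (min_le_right _ _)
      have h3 := abs_lt.1 h1
      have h4 := abs_le.1 (hclose i)
      linarith [h3.1, h3.2, h4.1, h4.2]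
  -- The total decrease under `f`. By compactness its infimum, zero by `happrox`, is attained; no
  -- coordinate decreases there, and equal sums force equality.
  let g : stdSimplex ℝ ι → ℝ := fun x => ∑ i, max 0 (x.1 i - (f x).1 i)
  have hcoord : ∀ i, Continuous fun x : stdSimplex ℝ ι => x.1 i := fun i =>
    (continuous_apply i).comp continuous_subtype_val
  have hg : Continuous g := continuous_finsetSum _ fun i _ =>
    continuous_const.max ((hcoord i).sub ((hcoord i).comp hf))
  obtain ⟨x₀, -⟩ := happrox 1 one_pos
  obtain ⟨x, -, hx⟩ := isCompact_univ.exists_isMinOn ⟨x₀, Set.mem_univ _⟩ hg.continuousOn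
  have hgx : g x ≤ 0 := by
    refine le_of_forall_pos_le_add fun ε hε => ?_
    have hcard : (0 : ℝ) < Fintype.card ι := by exact_mod_cast Fintype.card_pos
    obtain ⟨z, hz⟩ := happrox (ε / Fintype.card ι) (by positivity)
    calc g x ≤ g z := hx (Set.mem_univ z)
      _ ≤ ∑ _i : ι, ε / Fintype.card ι := Finset.sum_le_sum fun i _ =>
        max_le (by positivity) (by linarith [hz i])
      _ = 0 + ε := by
        rw [Finset.sum_const, Finset.card_univ, nsmul_eq_mul]
        field_simp
        ring
  have hle : ∀ i, x.1 i ≤ (f x).1 i := by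
    intro i
    have h := Finset.single_le_sum (f := fun i => max 0 (x.1 i - (f x).1 i))
      (fun i _ => le_max_left _ _) (Finset.mem_univ i)
    have := (le_max_right 0 (x.1 i - (f x).1 i)).trans (h.trans hgx)
    linarith
  refine ⟨x, Subtype.ext (funext fun i => ?_)⟩
  have := (Finset.sum_eq_sum_iff_of_le (s := Finset.univ) (fun i _ => hle i)).1
    (by rw [x.2.2, (f x).2.2])
  exact (this i (Finset.mem_univ i)).symm

/-! ### Closed graphs and the Kakutani–Fan–Glicksberg theorem -/

open Topology in
/-- An upper hemicontinuous correspondence with closed values in a regular space has closed graph. -/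
theorem UpperHemicontinuous.isClosed_graph {A B : Type*} [TopologicalSpace A] [TopologicalSpace B]
    [RegularSpace B] {f : A → Set B} (hf : UpperHemicontinuous f) (hc : ∀ a, IsClosed (f a)) :
    IsClosed {p : A × B | p.2 ∈ f p.1} := by
  rw [← isOpen_compl_iff, isOpen_iff_mem_nhds]
  rintro ⟨a, b⟩ hab
  have hdisj : Disjoint (𝓝ˢ (f a)) (𝓝 b) := by
    rw [disjoint_nhdsSet_nhds, (hc a).closure_eq]
    exact hab
  obtain ⟨t, ht, s, hs, hts⟩ := Filter.disjoint_iff.1 hdisj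
  have h := (upperHemicontinuousAt_iff.1 (upperHemicontinuous_iff.1 hf a)) t ht
  rw [nhds_prod_eq]
  filter_upwards [Filter.prod_mem_prod h hs] with p hp hpf
  exact Set.disjoint_left.1 hts (subset_of_mem_nhdsSet hp.1 hpf) hp.2

open Topology Uniformity in
/-- **The Kakutani–Fan–Glicksberg fixed point theorem**: a correspondence with closed graph and
nonempty convex values on a nonempty compact convex subset of a Hausdorff locally convex space has a
fixed point. The compact convex set is given as the image of an embedding `φ`. -/
theorem exists_mem_of_isClosed_graph {Z E : Type*} [TopologicalSpace Z] [CompactSpace Z]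
    [Nonempty Z] [AddCommGroup E] [Module ℝ E] [TopologicalSpace E] [IsTopologicalAddGroup E]
    [ContinuousSMul ℝ E] [LocallyConvexSpace ℝ E] [T2Space E] {φ : Z → E} (hφ : Continuous φ)
    (hφi : Function.Injective φ) (hconv : Convex ℝ (Set.range φ)) {G : Z → Set Z}
    (hG : IsClosed {p : Z × Z | p.2 ∈ G p.1}) (hGne : ∀ z, (G z).Nonempty)
    (hGconv : ∀ z, Convex ℝ (φ '' G z)) : ∃ z, z ∈ G z := by
  classical
  by_contra! hno
  have hT2 : T2Space Z := T2Space.of_injective_continuous hφi hφ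
  have hφc : IsClosedEmbedding φ := hφ.isClosedEmbedding hφi
  let _ : UniformSpace Z := uniformSpaceOfCompactR1
  have hGclosed : ∀ z, IsClosed (G z) := fun z =>
    hG.preimage (Continuous.prodMk_right z)
  -- One half-space separates `φ z'` from `φ '' G z'` for all `z'` near `z`: the points whose values
  -- reach the wrong side form the projection of a closed set along a compact factor, hence a closed
  -- set.
  have hsep : ∀ z, ∃ (N : Set Z) (O : Set E), IsOpen N ∧ z ∈ N ∧ Convex ℝ O ∧
      ∀ z' ∈ N, φ z' ∉ O ∧ ∀ y ∈ G z', φ y ∈ O := by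
    intro z
    obtain ⟨l, r, hlr, hlt⟩ := geometric_hahn_banach_point_closed (x := φ z) (hGconv z)
      (hφc.isClosedMap _ (hGclosed z)) (by rintro ⟨y, hy, h⟩; exact hno z (hφi h ▸ hy))
    have hlφ : Continuous fun y => l (φ y) := l.continuous.comp hφ
    let B : Set (Z × Z) := {p | p.2 ∈ G p.1} ∩ {p | l (φ p.2) ≤ r}
    have hB : IsClosed (Prod.fst '' B) := isClosedMap_fst_of_compactSpace _
      (hG.inter (isClosed_le (hlφ.comp continuous_snd) continuous_const))
    refine ⟨{y | l (φ y) < r} ∩ (Prod.fst '' B)ᶜ, {e | r < l e},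
      (isOpen_lt hlφ continuous_const).inter hB.isOpen_compl, ⟨hlr, ?_⟩,
      convex_halfSpace_gt l.isLinear r, fun z' hz' => ⟨fun h =>
        lt_asymm (show r < l (φ z') from h) hz'.1, fun y hy => ?_⟩⟩
    · rintro ⟨⟨z', y⟩, ⟨hy, hle⟩, rfl⟩
      exact absurd (hlt _ ⟨y, hy, rfl⟩) (not_lt.2 hle)
    · by_contra hle
      have hle' : l (φ y) ≤ r := not_lt.1 hle
      exact hz'.2 ⟨(z', y), ⟨hy, hle'⟩, rfl⟩
  choose N O hNo hzN hO hNO using hsep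
  obtain ⟨V, hV, hVN⟩ := lebesgue_number_lemma (isCompact_univ (X := Z)) hNo
    fun z _ => Set.mem_iUnion.2 ⟨z, hzN z⟩
  obtain ⟨t, ht⟩ : ∃ t : Finset Z, ∀ z, ∃ x ∈ t, z ∈ interior {z | (z, x) ∈ V} := by
    obtain ⟨t, ht⟩ := isCompact_univ.elim_finite_subcover
      (fun x : Z => interior {z | (z, x) ∈ V}) (fun _ => isOpen_interior)
      fun z _ => Set.mem_iUnion.2 ⟨z, mem_interior_iff_mem_nhds.2 (mem_nhds_right z hV)⟩
    exact ⟨t, fun z => by simpa using ht (Set.mem_univ z)⟩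
  obtain ⟨β, hβ⟩ := PartitionOfUnity.exists_isSubordinate (isClosed_univ (X := Z))
    (fun x : t => interior {z | (z, x.1) ∈ V}) (fun _ => isOpen_interior) fun z _ => by
      obtain ⟨x, hx, h⟩ := ht z
      exact Set.mem_iUnion.2 ⟨⟨x, hx⟩, h⟩
  choose y hy using hGne
  have : Nonempty t := by
    obtain ⟨x, hx, -⟩ := ht (Classical.arbitrary Z)
    exact ⟨⟨x, hx⟩⟩
  -- `p` sends weights to the barycentre of chosen values `y x ∈ G x`; `q` below returns the weights
  -- of the partition of unity.
  have hcomb : ∀ s : stdSimplex ℝ t, ∃ z, φ z = ∑ x, s.1 x • φ (y x.1) := fun s =>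
    hconv.sum_mem (fun x _ => s.2.1 x) s.2.2 fun x _ => Set.mem_range_self _
  choose p hp using hcomb
  have hpc : Continuous p := by
    rw [hφc.isInducing.continuous_iff]
    have : φ ∘ p = fun s : stdSimplex ℝ t => ∑ x, s.1 x • φ (y x.1) := funext hp
    rw [this]
    exact continuous_finsetSum _ fun x _ =>
      ((continuous_apply x).comp continuous_subtype_val).smul continuous_const
  let q : Z → stdSimplex ℝ t := fun z => ⟨fun x => β x z, fun x => β.nonneg x z, by
    rw [← finsum_eq_sum_of_fintype]
    exact β.sum_eq_one (Set.mem_univ z)⟩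
  have hq : Continuous q :=
    Continuous.subtype_mk (continuous_pi fun x => (β x).continuous) _
  obtain ⟨s, hs⟩ := exists_isFixedPt_stdSimplex (q ∘ p) (hq.comp hpc)
  -- Every `x` with positive weight at `p s` is `V`-close to it, hence lies in the same `N w`. So `φ
  -- (p s)` is a convex combination of points of `O w`, yet must avoid `O w`.
  obtain ⟨w, hw⟩ := hVN (p s) (Set.mem_univ _)
  have hpw : p s ∈ N w := hw (refl_mem_uniformity hV)
  refine (hNO w (p s) hpw).1 ?_
  rw [hp s, ← Finset.sum_filter_of_ne (p := fun x => s.1 x ≠ 0)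
    (fun x _ hx h => hx (by rw [h, zero_smul]))]
  refine (hO w).sum_mem (fun x _ => s.2.1 x) ?_ fun x hx => ?_
  · rw [Finset.sum_filter_ne_zero]
    exact s.2.2
  · have hne : β x (p s) ≠ 0 := by
      have : β x (p s) = s.1 x := congrFun (congrArg Subtype.val hs) x
      rw [this]
      exact (Finset.mem_filter.1 hx).2
    have hx' := interior_subset (hβ x (subset_tsupport _ hne))
    exact (hNO w x.1 (hw hx')).2 _ (hy x.1)

/-! ### The equilibrium theorem -/

/-- The correspondence which is single-valued and continuous on an open set `W`, and takes the whole
space as its value elsewhere, has closed graph. -/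
theorem isClosed_setOf_forall_mem_eq {A B : Type*} [TopologicalSpace A] [TopologicalSpace B]
    [T2Space B] {W : Set A} (hW : IsOpen W) {f : W → B} (hf : Continuous f) :
    IsClosed {p : A × B | ∀ h : p.1 ∈ W, p.2 = f ⟨p.1, h⟩} := by
  rw [← isOpen_compl_iff]
  have hopen : IsOpen {p : A × B | p.1 ∈ W} := hW.preimage continuous_fst
  have hne : IsOpen {p : {p : A × B | p.1 ∈ W} | p.1.2 ≠ f ⟨p.1.1, p.2⟩} :=
    isOpen_ne_fun (by fun_prop) (hf.comp (by fun_prop))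
  convert hopen.isOpenMap_subtype_val _ hne
  ext p
  simp only [Set.mem_compl_iff, Set.mem_ofPred_eq, not_forall, Set.mem_image, Subtype.exists,
    exists_and_right, exists_eq_right]
  exact Iff.rfl

theorem theorem9 {I J : Type*} {E : I → Type*} {F : J → Type*}
    [∀ i, AddCommGroup (E i)] [∀ i, Module ℝ (E i)] [∀ i, TopologicalSpace (E i)]
    [∀ i, IsTopologicalAddGroup (E i)] [∀ i, ContinuousSMul ℝ (E i)]
    [∀ i, LocallyConvexSpace ℝ (E i)] [∀ i, T2Space (E i)]
    [∀ j, AddCommGroup (F j)] [∀ j, Module ℝ (F j)] [∀ j, TopologicalSpace (F j)]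
    [∀ j, IsTopologicalAddGroup (F j)] [∀ j, ContinuousSMul ℝ (F j)]
    [∀ j, LocallyConvexSpace ℝ (F j)] [∀ j, T2Space (F j)]
    (X : ∀ i, Set (E i)) (Y : ∀ j, Set (F j))
    (hX_nonempty : ∀ i, (X i).Nonempty) (hX_compact : ∀ i, IsCompact (X i))
    (hX_convex : ∀ i, Convex ℝ (X i))
    (hY_nonempty : ∀ j, (Y j).Nonempty) (hY_compact : ∀ j, IsCompact (Y j))
    (hY_convex : ∀ j, Convex ℝ (Y j))
    (Φ : ∀ i, (∀ k, X k) × (∀ l, Y l) → Set (X i))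
    (Ψ : ∀ j, (∀ k, X k) × (∀ l, Y l) → Set (Y j))
    (hΦ_open : ∀ i, IsOpen (correspondenceDomain (Φ i)))
    (hΦ_selection : ∀ i, HasContinuousSelectionOn (Φ i) (correspondenceDomain (Φ i)))
    (hΨ_usc : ∀ j, UpperHemicontinuous (Ψ j))
    (hΨ_nonempty : ∀ j z, (Ψ j z).Nonempty)
    (hΨ_closed : ∀ j z, IsClosed (Ψ j z))
    (hΨ_convex : ∀ j z, Convex ℝ ((↑) '' Ψ j z : Set (F j))) :
    ∃ (x : ∀ i, X i) (y : ∀ j, Y j),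
      (∀ i, Φ i (x, y) = ∅ ∨ x i ∈ Φ i (x, y)) ∧ ∀ j, y j ∈ Ψ j (x, y) := by
  classical
  have hXc : ∀ i, CompactSpace (X i) := fun i => isCompact_iff_compactSpace.1 (hX_compact i)
  have hYc : ∀ j, CompactSpace (Y j) := fun j => isCompact_iff_compactSpace.1 (hY_compact j)
  have hXn : ∀ i, Nonempty (X i) := fun i => (hX_nonempty i).to_subtype
  have hYn : ∀ j, Nonempty (Y j) := fun j => (hY_nonempty j).to_subtype
  choose f hf hfΦ using hΦ_selection
  let φ : (∀ k, X k) × (∀ l, Y l) → (∀ k, E k) × (∀ l, F l) :=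
    fun z => (fun k => z.1 k, fun l => z.2 l)
  have hφ : Continuous φ := by fun_prop
  have hφi : Function.Injective φ := by
    rintro ⟨x, y⟩ ⟨x', y'⟩ h
    obtain ⟨h1, h2⟩ := Prod.mk.inj h
    exact Prod.ext (funext fun k => Subtype.ext (congrFun h1 k))
      (funext fun l => Subtype.ext (congrFun h2 l))
  have hconv : Convex ℝ (Set.range φ) := by
    have : Set.range φ = (Set.univ.pi X) ×ˢ (Set.univ.pi Y) := by
      ext ⟨x, y⟩
      constructor
      · rintro ⟨z, hz⟩
        rw [← hz]
        exact ⟨fun k _ => (z.1 k).2, fun l _ => (z.2 l).2⟩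
      · rintro ⟨hx, hy⟩
        exact ⟨(fun k => ⟨x k, hx k trivial⟩, fun l => ⟨y l, hy l trivial⟩), rfl⟩
    rw [this]
    exact (convex_pi fun k _ => hX_convex k).prod (convex_pi fun l _ => hY_convex l)
  let G : (∀ k, X k) × (∀ l, Y l) → Set ((∀ k, X k) × (∀ l, Y l)) := fun z =>
    {z' | (∀ i (hz : z ∈ correspondenceDomain (Φ i)), z'.1 i = f i ⟨z, hz⟩) ∧
      ∀ j, z'.2 j ∈ Ψ j z}
  obtain ⟨⟨x, y⟩, hx, hy⟩ : ∃ z, z ∈ G z := by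
    refine exists_mem_of_isClosed_graph hφ hφi hconv ?_ (fun z => ?_) fun z => ?_
    · have h1 : ∀ i, IsClosed {p : ((∀ k, X k) × (∀ l, Y l)) × ((∀ k, X k) × (∀ l, Y l)) |
          ∀ hz : p.1 ∈ correspondenceDomain (Φ i), p.2.1 i = f i ⟨p.1, hz⟩} := fun i =>
        (isClosed_setOf_forall_mem_eq (hΦ_open i) (hf i)).preimage
          (f := fun p : ((∀ k, X k) × (∀ l, Y l)) × ((∀ k, X k) × (∀ l, Y l)) => (p.1, p.2.1 i))
          (by fun_prop)
      have h2 : ∀ j, IsClosed {p : ((∀ k, X k) × (∀ l, Y l)) × ((∀ k, X k) × (∀ l, Y l)) |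
          p.2.2 j ∈ Ψ j p.1} := fun j =>
        ((hΨ_usc j).isClosed_graph (hΨ_closed j)).preimage
          (f := fun p : ((∀ k, X k) × (∀ l, Y l)) × ((∀ k, X k) × (∀ l, Y l)) => (p.1, p.2.2 j))
          (by fun_prop)
      have := (isClosed_iInter h1).inter (isClosed_iInter h2)
      convert this using 1
      ext p
      simp [G]
    · choose y hy using fun j => hΨ_nonempty j z
      -- Off the domain the factor is all of `X i`, so any point serves.
      exact ⟨(fun i => if hz : z ∈ correspondenceDomain (Φ i) then f i ⟨z, hz⟩
        else Classical.arbitrary _, y), fun i hz => by simp [hz], hy⟩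
    · have : φ '' G z =
          (Set.univ.pi fun i => X i ∩ {e | ∀ hz : z ∈ correspondenceDomain (Φ i),
            e = f i ⟨z, hz⟩}) ×ˢ (Set.univ.pi fun j => ((↑) '' Ψ j z : Set (F j))) := by
        ext ⟨x, y⟩
        constructor
        · rintro ⟨z', ⟨h1, h2⟩, hz'⟩
          rw [← hz']
          exact ⟨fun k _ => ⟨(z'.1 k).2, fun hz => congrArg Subtype.val (h1 k hz)⟩,
            fun l _ => ⟨_, h2 l, rfl⟩⟩
        · rintro ⟨hx, hy⟩
          choose y' hy' hyy' using fun l => hy l trivial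
          exact ⟨(fun k => ⟨x k, (hx k trivial).1⟩, y'),
            ⟨fun i hz => Subtype.ext ((hx i trivial).2 hz), hy'⟩,
            Prod.ext rfl (funext hyy')⟩
      rw [this]
      refine (convex_pi fun i _ => (hX_convex i).inter ?_).prod (convex_pi fun l _ => hΨ_convex l z)
      by_cases hz : z ∈ correspondenceDomain (Φ i)
      · simp [hz]
      · simp [hz, convex_univ]
  refine ⟨x, y, fun i => ?_, hy⟩
  by_cases hz : Φ i (x, y) = ∅
  · exact Or.inl hz
  · right
    rw [show x i = f i ⟨(x, y), hz⟩ from hx i hz]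
    exact hfΦ i ⟨(x, y), hz⟩
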